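/- Let $N,L\in\{1,2,\dots\}$, let $M\in\mathbb R^{N\times N}$ and $u\in\mathbb R^N$ have positive entries, and let $\|\cdot\|$ be a polyhedral norm on $\mathbb R^N$, that is, a norm of the form $\|x\|=\max_{1\le l\le L}a_l^{\mathsf T}|x|$ with vectors $a_1,\dots,a_L\in\mathbb R^N_{+}\setminus\{0\}$, where $|x|=(|x_n|)_n$. Put $G(x)=Mx+u\|x\|$ and $M_l=M+u a_l^{\mathsf T}$. For a positively homogeneous, order-preserving, continuous mapping $T:\mathbb R^N_+\to\mathbb R^N_+$ let $$\rho(T)=\sup\{\lambda\ge 0 : T(x)=\lambda x \text{ for some } x\in\mathbb R^N_+\setminus\{0\}\},$$ and for a nonnegative matrix $A$ let $\rho(A)$ be $\rho$ of the linear mapping $x\mapsto Ax$. For $x\in\mathbb R^N_+$ let $\varrho_T(x)=\rho(p\mapsto\mathrm{diag}(x)\,T(p))$, and write $\varrho_{M_l}$ for the function belonging to $x\mapsto M_lx$. Let $\mathfrak E(r)=(e^{r_n}-1)_{n}$, let $P$ be the Euclidean projection of $\mathbb R^N$ onto $\mathbb R^N_+$, and let $h_{G,\mathfrak E}=\varrho_G\circ\mathfrak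 E\circ P:\mathbb R^N\to\mathbb R$. Assume that $\varrho_{M_l}\circ\mathfrak E$ is convex on $\mathbb R^N_{++}=(0,\infty)^N$ for every $l\in\{1,\dots,L\}$. Let $r\in\mathbb R^N_{++}$ and let $l^\star\in\operatorname{argmax}_{l}(\varrho_{M_l}\circ\mathfrak E)(r)$. Then: 1. for every $l$, $(\varrho_{M_l}\circ\mathfrak E)(r)=\rho(\mathrm{diag}(\mathfrak E(r))M_l)$, and this number is the usual spectral radius (largest modulus of a complex eigenvalue) of the matrix $\mathrm{diag}(\mathfrak E(r))M_l$; 2. $h_{G,\mathfrak E}$ is convex on $\mathbb R^N$; 3. with $A=\mathrm{diag}(\mathfrak E(r))M_{l^\star}$ one has $\rho(A)>0$, and there are $\xi,\eta\in\mathbb R^N_{++}$ with $A\xi=\rho(A)\xi$ and $\eta^{\mathsf T}A=\rho(A)\eta^{\mathsf T}$; 4. for all $\xi,\eta\in\mathbb R^N_{++}$ with $A\xi=\rho(A)\xi$ and $\eta^{\mathsf T}A=\rho(A)\eta^{\mathsf T}$, the vector $$g=\frac{\mathrm{diag}\big((e^{r_n})_n\big)\,\mathrm{diag}(\eta)\,M_{l^\star}\,\xi}{\eta^{\mathsf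 T}\xi}$$ is a subgradient of $h_{G,\mathfrak E}$ at $r$, i.e. $\langle y-r,g\rangle+h_{G,\mathfrak E}(r)\le h_{G,\mathfrak E}(y)$ for every $y\in\mathbb R^N$. -/

import Mathlib

namespace RateRegion

variable {N L : ℕ}

/-- The spectral radius `ρ(G)` of a positively homogeneous, order-preserving, continuous
self-mapping `G` of the nonnegative orthant: the supremum of its eigenvalues `μ ≥ 0` with
eigenvectors in the orthant minus the origin. Only the values of `G` on the orthant matter. -/
noncomputable def rho (G : (Fin N → ℝ) → (Fin N → ℝ)) : ℝ :=
  sSup {μ : ℝ | 0 ≤ μ ∧ ∃ x : Fin N → ℝ, 0 ≤ x ∧ x ≠ 0 ∧ G x = μ • x}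

/-- The spectral radius of a nonnegative matrix, regarded as a linear self-mapping of the
nonnegative orthant. -/
noncomputable def rhoMat (A : Matrix (Fin N) (Fin N) ℝ) : ℝ :=
  rho (fun x => A.mulVec x)

/-- The nonlinear spectral radius function `ϱ_G`, sending `x ≥ 0` to the spectral radius of
`p ↦ diag(x) G(p)`. -/
noncomputable def varrho (G : (Fin N → ℝ) → (Fin N → ℝ)) (x : Fin N → ℝ) : ℝ :=
  rho (fun p => (Matrix.diagonal x).mulVec (G p))

/-- `ϱ_M` for a matrix `M`. -/
noncomputable def varrhoMat (M : Matrix (Fin N) (Fin N) ℝ) (x : Fin N → ℝ) : ℝ :=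
  varrho (fun p => M.mulVec p) x

/-- The mapping `𝔈 : r ↦ (e^{r_n} - 1)_n`. -/
noncomputable def vecExp (r : Fin N → ℝ) : Fin N → ℝ :=
  fun n => Real.exp (r n) - 1

/-- The positive orthant. -/
def posOrthant (N : ℕ) : Set (Fin N → ℝ) := {x | ∀ n, 0 < x n}

/-- The nonnegative orthant. -/
def nonnegOrthant (N : ℕ) : Set (Fin N → ℝ) := {x | ∀ n, 0 ≤ x n}

/-- The Euclidean distance `‖x - y‖₂`. -/
noncomputable def dist₂ (x y : Fin N → ℝ) : ℝ := ‖WithLp.toLp 2 (x - y)‖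

/-- `q` is a point of `C` nearest to `x` in the Euclidean norm. -/
def IsNearest (C : Set (Fin N → ℝ)) (x q : Fin N → ℝ) : Prop :=
  q ∈ C ∧ ∀ y ∈ C, dist₂ x q ≤ dist₂ x y

open Classical in
/-- The Euclidean projection onto `C` (meaningful where the nearest point exists and is
unique, in particular for nonempty closed convex `C`). -/
noncomputable def proj (C : Set (Fin N → ℝ)) (x : Fin N → ℝ) : Fin N → ℝ :=
  if h : ∃ q, IsNearest C x q then h.choose else x

/-- The nearest point of the nonnegative orthant exists and is unique. -/
theorem isNearest_nonnegOrthant_iff (x q : Fin N → ℝ) :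
    IsNearest (nonnegOrthant N) x q ↔ q = fun n => max 0 (x n) := by
  have hd : ∀ y : Fin N → ℝ, dist₂ x y = √(∑ n, (x n - y n) ^ 2) := by
    intro y
    simp [dist₂, EuclideanSpace.norm_eq]
  have hterm : ∀ y ∈ nonnegOrthant N, ∀ n,
      (x n - max 0 (x n)) ^ 2 + (y n - max 0 (x n)) ^ 2 ≤ (x n - y n) ^ 2 := by
    intro y hy n
    have hyn : 0 ≤ y n := hy n
    rcases le_total 0 (x n) with h | h
    · rw [max_eq_right h]
      nlinarith
    · rw [max_eq_left h]
      nlinarith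
  have hmem : (fun n => max 0 (x n)) ∈ nonnegOrthant N := fun n => le_max_left _ _
  constructor
  · rintro ⟨hq, hmin⟩
    have h1 := hmin _ hmem
    rw [hd, hd, Real.sqrt_le_sqrt_iff (Finset.sum_nonneg fun n _ => sq_nonneg _)] at h1
    have h2 := Finset.sum_le_sum fun n (_ : n ∈ Finset.univ) => hterm q hq n
    rw [Finset.sum_add_distrib] at h2
    have h3 : ∑ n, (q n - max 0 (x n)) ^ 2 = 0 :=
      le_antisymm (by linarith) (Finset.sum_nonneg fun n _ => sq_nonneg _)
    rw [Finset.sum_eq_zero_iff_of_nonneg fun n _ => sq_nonneg _] at h3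
    funext n
    have := h3 n (Finset.mem_univ n)
    exact sub_eq_zero.mp (pow_eq_zero_iff (two_ne_zero)|>.mp this)
  · rintro rfl
    refine ⟨hmem, fun y hy => ?_⟩
    rw [hd, hd]
    refine Real.sqrt_le_sqrt (Finset.sum_le_sum fun n _ => ?_)
    have := hterm y hy n
    nlinarith [sq_nonneg (y n - max 0 (x n))]

/-- The projection onto the nonnegative orthant is the coordinatewise positive part. -/
theorem proj_nonnegOrthant (x : Fin N → ℝ) :
    proj (nonnegOrthant N) x = fun n => max 0 (x n) := by
  have h : ∃ q, IsNearest (nonnegOrthant N) x q :=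
    ⟨_, (isNearest_nonnegOrthant_iff x _).mpr rfl⟩
  rw [proj, dif_pos h]
  exact (isNearest_nonnegOrthant_iff x _).mp h.choose_spec

/-- The function `h_{G,𝔈} = ϱ_G ∘ 𝔈 ∘ P` on `ℝ^N`, with `P` the projection onto the
nonnegative orthant. -/
noncomputable def hFun (G : (Fin N → ℝ) → (Fin N → ℝ)) (r : Fin N → ℝ) : ℝ :=
  varrho G (vecExp (proj (nonnegOrthant N) r))

/-- The subdifferential of `h : ℝ^N → ℝ` at `x`. -/
def subdifferential (h : (Fin N → ℝ) → ℝ) (x : Fin N → ℝ) : Set (Fin N → ℝ) :=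
  {v | ∀ y : Fin N → ℝ, (y - x) ⬝ᵥ v + h x ≤ h y}

/-- `p` is the polyhedral norm `x ↦ max_l a_lᵀ|x|` given by nonzero nonnegative vectors
`a_1, …, a_L`. -/
structure IsPolyhedralNorm (p : Seminorm ℝ (Fin N → ℝ)) (a : Fin L → Fin N → ℝ) : Prop where
  definite : ∀ x, p x = 0 → x = 0
  nonneg : ∀ l, 0 ≤ a l
  ne_zero : ∀ l, a l ≠ 0
  isGreatest : ∀ x : Fin N → ℝ,
    IsGreatest (Set.range fun l : Fin L => a l ⬝ᵥ fun n => |x n|) (p x)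

/-- The mapping `G(x) = M x + ‖x‖ u`. -/
noncomputable def mapG (M : Matrix (Fin N) (Fin N) ℝ) (u : Fin N → ℝ)
    (p : Seminorm ℝ (Fin N → ℝ)) (x : Fin N → ℝ) : Fin N → ℝ :=
  M.mulVec x + p x • u

/-- The matrix `M_l = M + u a_lᵀ`. -/
def matMl (M : Matrix (Fin N) (Fin N) ℝ) (u : Fin N → ℝ) (a : Fin L → Fin N → ℝ)
    (l : Fin L) : Matrix (Fin N) (Fin N) ℝ :=
  M + Matrix.vecMulVec u (a l)

/-- The matrix `diag(𝔈(r)) M_l`. -/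
noncomputable def matA (M : Matrix (Fin N) (Fin N) ℝ) (u : Fin N → ℝ) (a : Fin L → Fin N → ℝ)
    (r : Fin N → ℝ) (l : Fin L) : Matrix (Fin N) (Fin N) ℝ :=
  Matrix.diagonal (vecExp r) * matMl M u a l

/-- `ξ` is a positive right eigenvector of `A` for the eigenvalue `ρ(A)`. -/
def IsRightPerron (A : Matrix (Fin N) (Fin N) ℝ) (ξ : Fin N → ℝ) : Prop :=
  (∀ n, 0 < ξ n) ∧ A.mulVec ξ = rhoMat A • ξ

/-- `η` is a positive left eigenvector of `A` for the eigenvalue `ρ(A)`. -/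
def IsLeftPerron (A : Matrix (Fin N) (Fin N) ℝ) (η : Fin N → ℝ) : Prop :=
  (∀ n, 0 < η n) ∧ Matrix.vecMul η A = rhoMat A • η

end RateRegion

namespace RateRegion

open Filter Topology

variable {N L : ℕ}

/-! At an eigenvector `q ≥ 0` of `diag(x) G` the norm is attained by some `a_l`, so `G q = M_l q`
and `q` is an eigenvector of `diag(x) M_l` for the same eigenvalue. Since eigenvalues in the orthant
are unique and `M_l ≤ G` there, `ϱ_G = max_l ϱ_{M_l}` (`exists_varrho_mapG_eq`,
`varrhoMat_le_varrho_mapG`). Convexity of each `ϱ_{M_l} ∘ 𝔈` passes to the closed orthant by upper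
semicontinuity, to the whole space by monotonicity (`convexOn_hFun`), and to `G` as a maximum. The
maximum at `r` is attained at `l⋆`, so it suffices to find a subgradient for `M_{l⋆}`. The
eigenvalue is not differentiated. The Friedland–Karlin inequality (`log_rhoMat_add_sum_log_le`)
gives an explicit differentiable minorant along the segment to `y`, exact at `r`; its slope there is
`⟨y - r, g⟩`, and convexity bounds that slope by `h y - h r`. -/

/-- Continuous, positively homogeneous and strongly monotone mappings of the nonnegative
orthant. -/
structure IsStronglyMonotone (G : (Fin N → ℝ) → (Fin N → ℝ)) : Prop where
  continuous : Continuous G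
  map_smul : ∀ c : ℝ, 0 ≤ c → ∀ q : Fin N → ℝ, 0 ≤ q → G (c • q) = c • G q
  strict : ∀ q q' : Fin N → ℝ, 0 ≤ q → q ≤ q' → q ≠ q' → ∀ i, G q i < G q' i

/-! ### Nonlinear Perron–Frobenius theory on the orthant. -/

namespace IsStronglyMonotone

variable {G : (Fin N → ℝ) → (Fin N → ℝ)}

theorem map_zero (hG : IsStronglyMonotone G) : G 0 = 0 := by
  simpa using hG.map_smul 0 le_rfl 0 le_rfl

theorem mono (hG : IsStronglyMonotone G)
    {q q' : Fin N → ℝ} (hq : 0 ≤ q) (h : q ≤ q') : G q ≤ G q' := by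
  intro i
  rcases eq_or_ne q q' with rfl | hne
  · exact le_rfl
  · exact (hG.strict q q' hq h hne i).le

theorem pos (hG : IsStronglyMonotone G)
    {q : Fin N → ℝ} (hq : 0 ≤ q) (hq0 : q ≠ 0) (i : Fin N) : 0 < G q i := by
  have := hG.strict 0 q le_rfl hq hq0.symm i
  rwa [hG.map_zero] at this

theorem nonneg (hG : IsStronglyMonotone G) {q : Fin N → ℝ} (hq : 0 ≤ q) : 0 ≤ G q := by
  have := hG.mono le_rfl hq
  rwa [hG.map_zero] at this

/-- A positively homogeneous strongly monotone mapping scaled by a nonnegative diagonal has an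
eigenvector in the orthant. -/
theorem exists_eigenvector (hG : IsStronglyMonotone G) [NeZero N] {x : Fin N → ℝ} (hx : 0 ≤ x) :
    ∃ μ : ℝ, 0 ≤ μ ∧ ∃ q : Fin N → ℝ, 0 ≤ q ∧ q ≠ 0 ∧ ∀ i, x i * G q i = μ * q i := by
  set B : ℝ := ∑ i, x i * G 1 i
  -- Maximise `t` over pairs with `t q ≤ diag(x) G q` and `q` in the simplex; a maximiser must be an
  -- eigenvector.
  set K : Set (ℝ × (Fin N → ℝ)) :=
    (Set.Icc 0 B ×ˢ stdSimplex ℝ (Fin N)) ∩ {z | ∀ i, z.1 * z.2 i ≤ x i * G z.2 i}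
  have hbound : ∀ t : ℝ, ∀ q ∈ stdSimplex ℝ (Fin N), (∀ i, t * q i ≤ x i * G q i) → t ≤ B := by
    intro t q hq h
    calc t = ∑ i, t * q i := by rw [← Finset.mul_sum, hq.2, mul_one]
      _ ≤ ∑ i, x i * G 1 i := Finset.sum_le_sum fun i _ => (h i).trans <|
          mul_le_mul_of_nonneg_left (hG.mono hq.1 (fun j => by
            simpa using (hq.2 ▸ Finset.single_le_sum (fun k _ => hq.1 k) (Finset.mem_univ j) :
              q j ≤ 1)) i) (hx i)
  have hclosed : IsClosed {z : ℝ × (Fin N → ℝ) | ∀ i, z.1 * z.2 i ≤ x i * G z.2 i} := by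
    have hGi : ∀ i, Continuous fun z : ℝ × (Fin N → ℝ) => G z.2 i := fun i =>
      (continuous_apply i).comp (hG.continuous.comp continuous_snd)
    simp only [Set.ofPred_forall]
    exact isClosed_iInter fun i => isClosed_le (by fun_prop) (continuous_const.mul (hGi i))
  have hKc : IsCompact K :=
    (isCompact_Icc.prod (isCompact_stdSimplex ℝ (Fin N))).inter_right hclosed
  have hKn : K.Nonempty := by
    have hs := single_mem_stdSimplex ℝ (0 : Fin N)
    have h0 : ∀ i, (0 : ℝ) * (Pi.single 0 1 : Fin N → ℝ) i ≤ x i * G (Pi.single 0 1) i := by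
      intro i
      rw [zero_mul]
      exact mul_nonneg (hx i) (hG.nonneg hs.1 i)
    exact ⟨(0, Pi.single 0 1), ⟨⟨le_rfl, hbound 0 _ hs h0⟩, hs⟩, h0⟩
  obtain ⟨⟨t, q⟩, ⟨⟨⟨ht0, -⟩, hq⟩, hqt⟩, hmax⟩ :=
    hKc.exists_isMaxOn hKn continuous_fst.continuousOn
  simp only [Set.mem_ofPred_eq] at ht0 hq hqt
  have hq0 : q ≠ 0 := by
    rintro rfl
    simpa using hq.2
  refine ⟨t, ht0, q, hq.1, hq0, ?_⟩
  by_contra hne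
  -- If `t q ≠ q'`, strong monotonicity gives `t q' < diag(x) G q'` wherever `x i > 0`, while `q' i
  -- = 0` elsewhere. Hence `q'`, normalised, admits a larger `t`.
  set q' : Fin N → ℝ := fun i => x i * G q i
  have hqq' : t • q ≤ q' := fun i => hqt i
  have hq'n : 0 ≤ q' := fun i => mul_nonneg (hx i) (hG.nonneg hq.1 i)
  have hne' : t • q ≠ q' := fun h => hne fun i => (congrFun h i).symm
  have hq'0 : q' ≠ 0 := by
    intro h
    apply hne'
    rw [h] at hqq' ⊢
    exact le_antisymm hqq' (smul_nonneg ht0 hq.1)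
  have hlt := hG.strict _ _ (smul_nonneg ht0 hq.1) hqq' hne'
  rw [hG.map_smul t ht0 q hq.1] at hlt
  have hev : ∀ᶠ s in 𝓝[>] t, ∀ i, s * q' i ≤ x i * G q' i := by
    rw [eventually_all]
    intro i
    rcases (hx i).eq_or_lt with h0 | h0
    · simp [q', ← h0]
    · have hlt' : t * q' i < x i * G q' i := by
        have := mul_lt_mul_of_pos_left (hlt i) h0
        simp only [Pi.smul_apply, smul_eq_mul] at this
        simp only [q'] at this ⊢
        linarith
      have hc : Tendsto (fun s : ℝ => s * q' i) (𝓝 t) (𝓝 (t * q' i)) :=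
        (continuous_id.mul continuous_const).tendsto t
      exact ((hc.mono_left nhdsWithin_le_nhds).eventually_lt_const hlt').mono fun _ h => h.le
  obtain ⟨s, hs, hts⟩ := (hev.and self_mem_nhdsWithin).exists
  have hts : t < s := hts
  have hsum : 0 < ∑ i, q' i := by
    refine lt_of_le_of_ne (Finset.sum_nonneg fun i _ => hq'n i) fun h => hq'0 ?_
    rw [eq_comm, Finset.sum_eq_zero_iff_of_nonneg fun i _ => hq'n i] at h
    exact funext fun i => h i (Finset.mem_univ i)
  have hc0 : 0 ≤ (∑ i, q' i)⁻¹ := inv_nonneg.mpr hsum.le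
  have hmem : (∑ i, q' i)⁻¹ • q' ∈ stdSimplex ℝ (Fin N) := by
    refine ⟨fun i => smul_nonneg hc0 hq'n i, ?_⟩
    simp only [Pi.smul_apply, smul_eq_mul, ← Finset.mul_sum]
    exact inv_mul_cancel₀ hsum.ne'
  have hineq : ∀ i, s * ((∑ i, q' i)⁻¹ • q') i ≤ x i * G ((∑ i, q' i)⁻¹ • q') i := by
    intro i
    rw [hG.map_smul _ hc0 _ hq'n]
    simp only [Pi.smul_apply, smul_eq_mul]
    have := mul_le_mul_of_nonneg_left (hs i) hc0
    linarith
  have : s ≤ t := hmax (a := (s, (∑ i, q' i)⁻¹ • q'))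
    ⟨⟨⟨ht0.trans hts.le, hbound s _ hmem hineq⟩, hmem⟩, hineq⟩
  exact this.not_gt hts

/-- A lower Collatz–Wielandt value does not exceed an upper one. -/
theorem le_of_subeigenvector_of_supereigenvector (hG : IsStronglyMonotone G)
    {x q q' : Fin N → ℝ} {μ ν : ℝ} (hx : 0 ≤ x)
    (hq : 0 ≤ q) (hq0 : q ≠ 0) (hq' : 0 ≤ q') (hsupp : ∀ i, q' i = 0 → q i = 0)
    (h : ∀ i, μ * q i ≤ x i * G q i) (h' : ∀ i, x i * G q' i ≤ ν * q' i) : μ ≤ ν := by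
  obtain ⟨j, hj⟩ := Function.ne_iff.mp hq0
  have : Nonempty (Fin N) := ⟨j⟩
  -- The least multiple of `q'` dominating `q` touches it at `i`; `G` is compared there. Where `q'`
  -- vanishes the ratio is `0` by convention, and `hsupp` makes `q` vanish too.
  obtain ⟨i, hi⟩ := Finite.exists_max fun i => q i / q' i
  have hqj : 0 < q j := lt_of_le_of_ne (hq j) (Ne.symm hj)
  have hpos : ∀ k, 0 < q k → 0 < q' k := fun k hk =>
    lt_of_le_of_ne (hq' k) fun h0 => hk.ne' (hsupp k h0.symm)
  have hs : 0 < q i / q' i := (div_pos hqj (hpos j hqj)).trans_le (hi j)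
  have hqi' : q' i ≠ 0 := fun h0 => by simp [h0] at hs
  have hqi : 0 < q i :=
    lt_of_le_of_ne (hq i) fun h0 => by simp [← h0] at hs
  have hle : q ≤ (q i / q' i) • q' := by
    intro k
    rcases (hq k).eq_or_lt with h0 | h0
    · rw [← h0]
      exact smul_nonneg hs.le hq' k
    · exact (div_le_iff₀ (hpos k h0)).mp (hi k)
  have hG' := hG.mono hq hle i
  rw [hG.map_smul _ hs.le _ hq'] at hG'
  have key : μ * q i ≤ ν * q i := by
    calc μ * q i ≤ x i * G q i := h i
      _ ≤ x i * ((q i / q' i) * G q' i) := mul_le_mul_of_nonneg_left hG' (hx i)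
      _ = (q i / q' i) * (x i * G q' i) := by ring
      _ ≤ (q i / q' i) * (ν * q' i) := mul_le_mul_of_nonneg_left (h' i) hs.le
      _ = ν * q i := by field_simp
  exact le_of_mul_le_mul_right key hqi

/-- An eigenvector meets the support condition automatically for `μ > 0`: `G q'` is strictly
positive, so `q' i = 0` forces `x i = 0` and then `q i = 0`. -/
theorem le_of_subeigenvector_of_eigenvector (hG : IsStronglyMonotone G)
    {x q q' : Fin N → ℝ} {μ ν : ℝ} (hx : 0 ≤ x)
    (hq : 0 ≤ q) (hq0 : q ≠ 0) (hq' : 0 ≤ q') (hq'0 : q' ≠ 0) (hν : 0 ≤ ν)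
    (h : ∀ i, μ * q i ≤ x i * G q i) (h' : ∀ i, x i * G q' i = ν * q' i) : μ ≤ ν := by
  rcases le_or_gt μ 0 with hμ | hμ
  · exact hμ.trans hν
  refine hG.le_of_subeigenvector_of_supereigenvector hx hq hq0 hq' (fun i hi => ?_) h
    fun i => (h' i).le
  have hxi : x i = 0 := by
    have := h' i
    rw [hi, mul_zero] at this
    exact (mul_eq_zero.mp this).resolve_right (hG.pos hq' hq'0 i).ne'
  have := h i
  rw [hxi, zero_mul] at this
  exact le_antisymm (nonpos_of_mul_nonpos_right this hμ) (hq i)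

/-- Comparing two eigenvectors in both directions shows that the set under the supremum is a
singleton. -/
theorem varrho_eq (hG : IsStronglyMonotone G)
    {x q : Fin N → ℝ} {μ : ℝ} (hx : 0 ≤ x) (hμ : 0 ≤ μ) (hq : 0 ≤ q) (hq0 : q ≠ 0)
    (h : ∀ i, x i * G q i = μ * q i) : varrho G x = μ := by
  have : {ν : ℝ | 0 ≤ ν ∧ ∃ y : Fin N → ℝ, 0 ≤ y ∧ y ≠ 0 ∧
      (Matrix.diagonal x).mulVec (G y) = ν • y} = {μ} := by
    ext ν
    simp only [Set.mem_ofPred_eq, Set.mem_singleton_iff]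
    constructor
    · rintro ⟨hν, y, hy, hy0, hGy⟩
      have hy' : ∀ i, x i * G y i = ν * y i := fun i => by
        simpa [Matrix.mulVec_diagonal] using congrFun hGy i
      exact le_antisymm
        (hG.le_of_subeigenvector_of_eigenvector hx hy hy0 hq hq0 hμ (fun i => (hy' i).ge) h)
        (hG.le_of_subeigenvector_of_eigenvector hx hq hq0 hy hy0 hν (fun i => (h i).ge) hy')
    · rintro rfl
      exact ⟨hμ, q, hq, hq0, funext fun i => by simpa [Matrix.mulVec_diagonal] using h i⟩
  rw [varrho, rho, this, csSup_singleton]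

theorem varrho_spec (hG : IsStronglyMonotone G) [NeZero N] {x : Fin N → ℝ} (hx : 0 ≤ x) :
    0 ≤ varrho G x ∧
      ∃ q : Fin N → ℝ, 0 ≤ q ∧ q ≠ 0 ∧ ∀ i, x i * G q i = varrho G x * q i := by
  obtain ⟨μ, hμ, q, hq, hq0, h⟩ := hG.exists_eigenvector hx
  rw [hG.varrho_eq hx hμ hq hq0 h]
  exact ⟨hμ, q, hq, hq0, h⟩

/-- For a positive scaling the spectral radius and the eigenvector are positive. -/
theorem varrho_spec_pos (hG : IsStronglyMonotone G) [NeZero N] {x : Fin N → ℝ} (hx : ∀ i, 0 < x i) :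
    0 < varrho G x ∧
      ∃ q : Fin N → ℝ, (∀ i, 0 < q i) ∧ ∀ i, x i * G q i = varrho G x * q i := by
  obtain ⟨hμ, q, hq, hq0, h⟩ := hG.varrho_spec (fun i => (hx i).le : 0 ≤ x)
  have hpos : ∀ i, 0 < varrho G x * q i := fun i => h i ▸ mul_pos (hx i) (hG.pos hq hq0 i)
  exact ⟨pos_of_mul_pos_left (hpos 0) (hq 0), q,
    fun i => pos_of_mul_pos_right (hpos i) hμ, h⟩

theorem le_varrho (hG : IsStronglyMonotone G)
    [NeZero N] {x q : Fin N → ℝ} {t : ℝ} (hx : 0 ≤ x) (hq : 0 ≤ q) (hq0 : q ≠ 0)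
    (h : ∀ i, t * q i ≤ x i * G q i) : t ≤ varrho G x := by
  obtain ⟨hν, y, hy, hy0, hGy⟩ := hG.varrho_spec hx
  exact hG.le_of_subeigenvector_of_eigenvector hx hq hq0 hy hy0 hν h hGy

theorem varrho_le (hG : IsStronglyMonotone G)
    [NeZero N] {x q : Fin N → ℝ} {t : ℝ} (hx : 0 ≤ x) (hq : ∀ i, 0 < q i)
    (h : ∀ i, x i * G q i ≤ t * q i) : varrho G x ≤ t := by
  obtain ⟨-, y, hy, hy0, hGy⟩ := hG.varrho_spec hx
  exact hG.le_of_subeigenvector_of_supereigenvector hx hy hy0 (fun i => (hq i).le)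
    (fun i hi => absurd hi (hq i).ne') (fun i => (hGy i).ge) h

theorem varrho_mono (hG : IsStronglyMonotone G)
    [NeZero N] {x y : Fin N → ℝ} (hx : 0 ≤ x) (hxy : x ≤ y) :
    varrho G x ≤ varrho G y := by
  obtain ⟨-, q, hq, hq0, h⟩ := hG.varrho_spec hx
  exact hG.le_varrho (hx.trans hxy) hq hq0 fun i =>
    (h i).ge.trans (mul_le_mul_of_nonneg_right (hxy i) (hG.nonneg hq i))

theorem varrho_le_varrho (hG : IsStronglyMonotone G)
    [NeZero N] {H : (Fin N → ℝ) → (Fin N → ℝ)} (hH : IsStronglyMonotone H)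
    (hle : ∀ q, 0 ≤ q → G q ≤ H q) {x : Fin N → ℝ} (hx : 0 ≤ x) :
    varrho G x ≤ varrho H x := by
  obtain ⟨-, q, hq, hq0, h⟩ := hG.varrho_spec hx
  exact hH.le_varrho hx hq hq0 fun i =>
    (h i).ge.trans (mul_le_mul_of_nonneg_left (hle q hq i) (hx i))

/-- The spectral radius is upper semicontinuous on the orthant, including its boundary. -/
theorem eventually_varrho_le (hG : IsStronglyMonotone G)
    [NeZero N] {x : Fin N → ℝ} (hx : 0 ≤ x) {ε : ℝ} (hε : 0 < ε) :
    ∀ᶠ y in 𝓝 x, 0 ≤ y → varrho G y ≤ varrho G x + ε := by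
  obtain ⟨hμ, q, hq, hq0, h⟩ := hG.varrho_spec hx
  -- Raising `q` by `δ` makes it a positive, strict supereigenvector for `ϱ + ε`: a zero coordinate
  -- of `q` has `x i = 0`. Strictness survives small changes of `x`.
  have hev : ∀ᶠ δ in 𝓝[>] (0 : ℝ), ∀ i,
      x i * G (q + fun _ => δ) i < (varrho G x + ε) * (q i + δ) := by
    rw [eventually_all]
    intro i
    rcases (hq i).eq_or_lt with h0 | h0
    · have hxi : x i = 0 := by
        have := h i
        rw [← h0, Pi.zero_apply, mul_zero] at this
        exact (mul_eq_zero.mp this).resolve_right (hG.pos hq hq0 i).ne'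
      filter_upwards [self_mem_nhdsWithin] with δ (hδ : 0 < δ)
      rw [hxi, zero_mul, ← h0, Pi.zero_apply]
      positivity
    · have hc1 : Continuous fun δ : ℝ => x i * G (q + fun _ => δ) i :=
        continuous_const.mul ((continuous_apply i).comp (hG.continuous.comp (by fun_prop)))
      have hc2 : Continuous fun δ : ℝ => (varrho G x + ε) * (q i + δ) := by fun_prop
      refine nhdsWithin_le_nhds ((hc1.tendsto 0).eventually_lt (hc2.tendsto 0) ?_)
      have hz : (q + fun _ => (0 : ℝ)) = q := by
        ext
        simp
      rw [hz, h i, add_zero]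
      exact mul_lt_mul_of_pos_right (by linarith) h0
  obtain ⟨δ, hδ, hδ0⟩ := (hev.and self_mem_nhdsWithin).exists
  have hδ0 : 0 < δ := hδ0
  have hev' : ∀ᶠ y in 𝓝 x, ∀ i,
      y i * G (q + fun _ => δ) i < (varrho G x + ε) * (q i + δ) := by
    rw [eventually_all]
    intro i
    have hc : Continuous fun y : Fin N → ℝ => y i * G (q + fun _ => δ) i := by fun_prop
    exact (hc.tendsto x).eventually_lt_const (hδ i)
  filter_upwards [hev'] with y hy hy0
  exact hG.varrho_le hy0 (q := q + fun _ => δ)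
    (fun i => add_pos_of_nonneg_of_pos (hq i) hδ0) fun i => (hy i).le

end IsStronglyMonotone

/-! ### The mapping `G` as an upper envelope of the matrices `M_l`. -/

theorem isStronglyMonotone_mulVec {A : Matrix (Fin N) (Fin N) ℝ} (hA : ∀ i j, 0 < A i j) :
    IsStronglyMonotone fun q => A.mulVec q where
  continuous := by fun_prop
  map_smul c _ q _ := Matrix.mulVec_smul A c q
  strict q q' _ hle hne i := by
    obtain ⟨j, hj⟩ := Function.ne_iff.mp hne
    exact Finset.sum_lt_sum (fun k _ => mul_le_mul_of_nonneg_left (hle k) (hA i k).le)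
      ⟨j, Finset.mem_univ j, mul_lt_mul_of_pos_left (lt_of_le_of_ne (hle j) hj) (hA i j)⟩

theorem matMl_pos {M : Matrix (Fin N) (Fin N) ℝ} (hM : ∀ i j, 0 < M i j) {u : Fin N → ℝ}
    (hu : ∀ i, 0 < u i) {a : Fin L → Fin N → ℝ} (ha : ∀ l, 0 ≤ a l) (l : Fin L) (i j : Fin N) :
    0 < matMl M u a l i j :=
  add_pos_of_pos_of_nonneg (hM i j) (mul_nonneg (hu i).le (ha l j))

theorem matMl_mulVec (M : Matrix (Fin N) (Fin N) ℝ) (u : Fin N → ℝ) (a : Fin L → Fin N → ℝ)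
    (l : Fin L) (q : Fin N → ℝ) : (matMl M u a l).mulVec q = M.mulVec q + (a l ⬝ᵥ q) • u := by
  ext i
  simp [matMl, Matrix.add_mulVec, Matrix.vecMulVec_mulVec, mul_comm]

namespace IsPolyhedralNorm

variable {p : Seminorm ℝ (Fin N → ℝ)} {a : Fin L → Fin N → ℝ}

theorem isGreatest_of_nonneg (hp : IsPolyhedralNorm p a) {q : Fin N → ℝ} (hq : 0 ≤ q) :
    IsGreatest (Set.range fun l => a l ⬝ᵥ q) (p q) := by
  have := hp.isGreatest q
  rwa [show (fun n => |q n|) = q from funext fun n => abs_of_nonneg (hq n)] at this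

theorem mono (hp : IsPolyhedralNorm p a)
    {q q' : Fin N → ℝ} (hq : 0 ≤ q) (h : q ≤ q') : p q ≤ p q' := by
  obtain ⟨l, hl⟩ := (hp.isGreatest_of_nonneg hq).1
  rw [← hl]
  exact (dotProduct_le_dotProduct_of_nonneg_left h (hp.nonneg l)).trans
    ((hp.isGreatest_of_nonneg (hq.trans h)).2 ⟨l, rfl⟩)

theorem isStronglyMonotone_mapG (hp : IsPolyhedralNorm p a)
    {M : Matrix (Fin N) (Fin N) ℝ} (hM : ∀ i j, 0 < M i j)
    {u : Fin N → ℝ} (hu : ∀ i, 0 < u i) : IsStronglyMonotone (mapG M u p) where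
  continuous := by
    have hpc : Continuous p := continuousOn_univ.mp (p.convexOn.continuousOn isOpen_univ)
    unfold mapG
    fun_prop
  map_smul c hc q _ := by
    ext i
    simp [mapG, Matrix.mulVec_smul, map_smul_eq_mul, abs_of_nonneg hc]
    ring
  strict q q' hq hle hne i :=
    add_lt_add_of_lt_of_le ((isStronglyMonotone_mulVec hM).strict q q' hq hle hne i)
      (mul_le_mul_of_nonneg_right (hp.mono hq hle) (hu i).le)

theorem varrhoMat_le_varrho_mapG (hp : IsPolyhedralNorm p a)
    [NeZero N] {M : Matrix (Fin N) (Fin N) ℝ}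
    (hM : ∀ i j, 0 < M i j) {u : Fin N → ℝ} (hu : ∀ i, 0 < u i) {x : Fin N → ℝ} (hx : 0 ≤ x)
    (l : Fin L) : varrhoMat (matMl M u a l) x ≤ varrho (mapG M u p) x := by
  refine (isStronglyMonotone_mulVec (matMl_pos hM hu hp.nonneg l)).varrho_le_varrho
    (hp.isStronglyMonotone_mapG hM hu) (fun q hq => ?_) hx
  rw [matMl_mulVec]
  exact fun i => add_le_add_right
    (mul_le_mul_of_nonneg_right ((hp.isGreatest_of_nonneg hq).2 ⟨l, rfl⟩) (hu i).le) _

/-- Choose `l` attaining the norm at the eigenvector of `diag(x) G`, where `G` and `M_l` then agree.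
-/
theorem exists_varrho_mapG_eq (hp : IsPolyhedralNorm p a) [NeZero N] {M : Matrix (Fin N) (Fin N) ℝ}
    (hM : ∀ i j, 0 < M i j) {u : Fin N → ℝ} (hu : ∀ i, 0 < u i) {x : Fin N → ℝ} (hx : 0 ≤ x) :
    ∃ l, varrho (mapG M u p) x = varrhoMat (matMl M u a l) x := by
  obtain ⟨hμ, q, hq, hq0, h⟩ := (hp.isStronglyMonotone_mapG hM hu).varrho_spec hx
  obtain ⟨l, hl⟩ := (hp.isGreatest_of_nonneg hq).1
  refine ⟨l, ((isStronglyMonotone_mulVec (matMl_pos hM hu hp.nonneg l)).varrho_eq hx hμ hq hq0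
    fun i => ?_).symm⟩
  rw [← h i, matMl_mulVec, mapG, ← hl]

end IsPolyhedralNorm

/-! ### Perron vectors of positive matrices. -/

theorem varrhoMat_eq_rhoMat (A : Matrix (Fin N) (Fin N) ℝ) (x : Fin N → ℝ) :
    varrhoMat A x = rhoMat (Matrix.diagonal x * A) := by
  simp only [varrhoMat, varrho, rhoMat, Matrix.mulVec_mulVec]

section PositiveMatrix

variable {A : Matrix (Fin N) (Fin N) ℝ}

theorem rhoMat_eq_varrhoMat_one (A : Matrix (Fin N) (Fin N) ℝ) : rhoMat A = varrhoMat A 1 := by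
  rw [varrhoMat_eq_rhoMat, Matrix.diagonal_one', one_mul]

theorem rhoMat_pos [NeZero N] (hA : ∀ i j, 0 < A i j) : 0 < rhoMat A := by
  rw [rhoMat_eq_varrhoMat_one]
  exact ((isStronglyMonotone_mulVec hA).varrho_spec_pos fun _ => one_pos).1

theorem exists_isRightPerron [NeZero N] (hA : ∀ i j, 0 < A i j) : ∃ ξ, IsRightPerron A ξ := by
  obtain ⟨q, hq, h⟩ :=
    ((isStronglyMonotone_mulVec hA).varrho_spec_pos (x := 1) fun _ => one_pos).2
  refine ⟨q, hq, funext fun i => ?_⟩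
  rw [rhoMat_eq_varrhoMat_one, varrhoMat]
  simpa using h i

/-- The transpose supplies `η`; evaluating `ηᵀ A ξ` in two ways, with `ηᵀ ξ > 0`, identifies its
eigenvalue with `ρ(A)`. -/
theorem exists_isLeftPerron [NeZero N] (hA : ∀ i j, 0 < A i j) : ∃ η, IsLeftPerron A η := by
  obtain ⟨ξ, hξ, hAξ⟩ := exists_isRightPerron hA
  obtain ⟨η, hη, hAη⟩ := exists_isRightPerron (A := A.transpose) fun i j => hA j i
  rw [Matrix.mulVec_transpose] at hAη
  have hpos : 0 < η ⬝ᵥ ξ :=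
    Finset.sum_pos (fun i _ => mul_pos (hη i) (hξ i)) Finset.univ_nonempty
  have heq : rhoMat A * (η ⬝ᵥ ξ) = rhoMat A.transpose * (η ⬝ᵥ ξ) := by
    rw [← smul_eq_mul, ← smul_eq_mul, ← dotProduct_smul, ← smul_dotProduct, ← hAξ, ← hAη,
      Matrix.dotProduct_mulVec]
  exact ⟨η, hη, by rw [hAη, mul_right_cancel₀ hpos.ne' heq]⟩

/-- For a positive matrix the cone spectral radius is the usual spectral radius. -/
theorem spectralRadius_map_ofReal [NeZero N] (hA : ∀ i j, 0 < A i j) :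
    spectralRadius ℂ (A.map fun t : ℝ => (t : ℂ)) = ENNReal.ofReal (rhoMat A) := by
  have hρ := rhoMat_pos hA
  obtain ⟨ξ, hξ, hAξ⟩ := exists_isRightPerron hA
  obtain ⟨η, hη, hAη⟩ := exists_isLeftPerron hA
  have hspec : ∀ k : ℂ, k ∈ spectrum ℂ (A.map fun t : ℝ => (t : ℂ)) ↔
      ∃ v : Fin N → ℂ, (A.map fun t : ℝ => (t : ℂ)).mulVec v = k • v ∧ v ≠ 0 := by
    intro k
    rw [← Matrix.spectrum_toLin', ← Module.End.hasEigenvalue_iff_mem_spectrum]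
    constructor
    · intro h
      obtain ⟨v, hv⟩ := h.exists_hasEigenvector
      exact ⟨v, by simpa using hv.apply_eq_smul, hv.2⟩
    · rintro ⟨v, hv, hv0⟩
      exact Module.End.hasEigenvalue_of_hasEigenvector
        ⟨Module.End.mem_eigenspace_iff.mpr (by simpa using hv), hv0⟩
  rw [spectralRadius]
  apply le_antisymm
  · refine iSup₂_le fun k hk => ?_
    obtain ⟨v, hv, hv0⟩ := (hspec k).mp hk
    rw [← enorm_eq_nnnorm, ← ofReal_norm]
    refine ENNReal.ofReal_le_ofReal ?_
    obtain ⟨j, hj⟩ := Function.ne_iff.mp hv0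
    have hpos : 0 < η ⬝ᵥ fun i => ‖v i‖ :=
      Finset.sum_pos' (fun i _ => mul_nonneg (hη i).le (norm_nonneg _))
        ⟨j, Finset.mem_univ j, mul_pos (hη j) (norm_pos_iff.mpr hj)⟩
    -- Triangle inequality; pairing with the positive left eigenvector then gives `‖k‖ ≤ ρ(A)`.
    have hle : (‖k‖ • fun i => ‖v i‖) ≤ A.mulVec fun i => ‖v i‖ := by
      intro i
      have hi := congrFun hv i
      simp only [Pi.smul_apply, smul_eq_mul] at hi ⊢
      rw [← norm_mul, ← hi]
      refine (norm_sum_le Finset.univ fun j => (A i j : ℂ) * v j).trans <|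
        Finset.sum_le_sum fun j _ => ?_
      simp [abs_of_pos (hA i j)]
    have h := dotProduct_le_dotProduct_of_nonneg_left hle (fun i => (hη i).le : 0 ≤ η)
    rw [Matrix.dotProduct_mulVec, hAη, dotProduct_smul, smul_dotProduct] at h
    exact le_of_mul_le_mul_right h hpos
  · have hmem : ((rhoMat A : ℝ) : ℂ) ∈ spectrum ℂ (A.map fun t : ℝ => (t : ℂ)) := by
      refine (hspec _).mpr ⟨fun i => (ξ i : ℂ), funext fun i => ?_, fun h => ?_⟩
      · have := congrArg (fun t : ℝ => (t : ℂ)) (congrFun hAξ i)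
        simpa [Matrix.mulVec, dotProduct] using this
      · have := congrFun h 0
        simp [(hξ 0).ne'] at this
    refine le_trans ?_ (le_iSup₂ (f := fun (k : ℂ) (_ : k ∈ spectrum ℂ _) => (‖k‖₊ : ENNReal))
      _ hmem)
    rw [← enorm_eq_nnnorm, ← ofReal_norm, Complex.norm_real, Real.norm_of_nonneg hρ.le]

/-- The Friedland–Karlin inequality: with `w = η ∘ ξ` for the Perron vectors of `A`, an eigenvalue
`μ` of `diag(D) A` satisfies `ρ(A)^{∑ w} ∏ Dᵢ^{wᵢ} ≤ μ^{∑ w}`. -/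
theorem log_rhoMat_add_sum_log_le (hA : ∀ i j, 0 < A i j) (hρ : 0 < rhoMat A)
    {ξ η ζ D : Fin N → ℝ} {μ : ℝ} (hξ : IsRightPerron A ξ) (hη : IsLeftPerron A η)
    (hD : ∀ i, 0 < D i) (hμ : 0 < μ) (hζ : ∀ i, 0 < ζ i)
    (h : ∀ i, D i * A.mulVec ζ i = μ * ζ i) :
    (η ⬝ᵥ ξ) * Real.log (rhoMat A) + ∑ i, η i * ξ i * Real.log (D i) ≤
      (η ⬝ᵥ ξ) * Real.log μ := by
  obtain ⟨hξ0, hAξ⟩ := hξ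
  obtain ⟨hη0, hAη⟩ := hη
  set ρ := rhoMat A
  have hAξ' : ∀ i, ∑ j, A i j * ξ j = ρ * ξ i := fun i => congrFun hAξ i
  have hAη' : ∀ j, ∑ i, η i * A i j = ρ * η j := fun j => congrFun hAη j
  -- The weights `A i j ξ j / (ρ ξ i)` form a stochastic matrix; apply Jensen for `log` to each row.
  have hrow : ∀ i, ∑ j, A i j * ξ j / (ρ * ξ i) * Real.log (ζ j / ξ j) ≤
      Real.log μ - Real.log (D i) - Real.log ρ + Real.log (ζ i / ξ i) := by
    intro i
    have hρξ : 0 < ρ * ξ i := mul_pos hρ (hξ0 i)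
    have hJ := strictConcaveOn_log_Ioi.concaveOn.le_map_sum (t := Finset.univ)
      (w := fun j => A i j * ξ j / (ρ * ξ i)) (p := fun j => ζ j / ξ j)
      (fun j _ => (div_pos (mul_pos (hA i j) (hξ0 j)) hρξ).le)
      (by rw [← Finset.sum_div, hAξ' i, div_self hρξ.ne'])
      (fun j _ => div_pos (hζ j) (hξ0 j))
    simp only [smul_eq_mul] at hJ
    refine hJ.trans (le_of_eq ?_)
    have hsum : ∑ j, A i j * ξ j / (ρ * ξ i) * (ζ j / ξ j) = μ / D i / ρ * (ζ i / ξ i) := by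
      have h1 : ∀ j, A i j * ξ j / (ρ * ξ i) * (ζ j / ξ j) = A i j * ζ j / (ρ * ξ i) := by
        intro j
        have := (hξ0 j).ne'
        field_simp
      have h2 : ∑ j, A i j * ζ j = μ * ζ i / D i :=
        (eq_div_iff (hD i).ne').mpr (by rw [mul_comm]; exact h i)
      rw [Finset.sum_congr rfl fun j _ => h1 j, ← Finset.sum_div, h2]
      have := (hξ0 i).ne'
      have := (hD i).ne'
      field_simp
    have hz : ζ i / ξ i ≠ 0 := (div_pos (hζ i) (hξ0 i)).ne'
    rw [hsum, Real.log_mul (div_pos (div_pos hμ (hD i)) hρ).ne' hz,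
      Real.log_div (div_pos hμ (hD i)).ne' hρ.ne', Real.log_div hμ.ne' (hD i).ne']
  -- The weights `η i ξ i` are stationary for that matrix, so the unknown `log (ζ / ξ)` terms cancel
  -- in the weighted sum of rows.
  have hstat : ∑ i, η i * ξ i * ∑ j, A i j * ξ j / (ρ * ξ i) * Real.log (ζ j / ξ j) =
      ∑ j, η j * ξ j * Real.log (ζ j / ξ j) := by
    simp only [Finset.mul_sum]
    rw [Finset.sum_comm]
    refine Finset.sum_congr rfl fun j _ => ?_
    have h1 : ∀ i, η i * ξ i * (A i j * ξ j / (ρ * ξ i) * Real.log (ζ j / ξ j)) =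
        η i * A i j * (ξ j / ρ * Real.log (ζ j / ξ j)) := by
      intro i
      have := (hξ0 i).ne'
      field_simp
    rw [Finset.sum_congr rfl fun i _ => h1 i, ← Finset.sum_mul, hAη' j]
    field_simp
  have hall := Finset.sum_le_sum fun i (_ : i ∈ Finset.univ) =>
    mul_le_mul_of_nonneg_left (hrow i) (mul_pos (hη0 i) (hξ0 i)).le
  rw [hstat] at hall
  simp only [mul_add, mul_sub, Finset.sum_add_distrib, Finset.sum_sub_distrib,
    ← Finset.sum_mul] at hall
  simp only [dotProduct]
  linarith

end PositiveMatrix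

/-! ### Extending convexity from the open orthant to the whole space. -/

section Convexity

theorem vecExp_mono {r s : Fin N → ℝ} (h : r ≤ s) : vecExp r ≤ vecExp s :=
  fun n => sub_le_sub_right (Real.exp_le_exp.mpr (h n)) 1

theorem vecExp_nonneg {r : Fin N → ℝ} (h : 0 ≤ r) : 0 ≤ vecExp r :=
  fun n => sub_nonneg.mpr (Real.one_le_exp (h n))

theorem vecExp_pos {r : Fin N → ℝ} (h : r ∈ posOrthant N) (n : Fin N) : 0 < vecExp r n :=
  sub_pos.mpr (Real.one_lt_exp_iff.mpr (h n))

/-- Convexity of `ϱ_G ∘ 𝔈` on the open orthant extends to `ϱ_G ∘ 𝔈 ∘ P` on the whole space. -/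
theorem IsStronglyMonotone.convexOn_hFun [NeZero N] {G : (Fin N → ℝ) → (Fin N → ℝ)}
    (hG : IsStronglyMonotone G) (hc : ConvexOn ℝ (posOrthant N) fun r => varrho G (vecExp r)) :
    ConvexOn ℝ Set.univ (hFun G) := by
  refine ⟨convex_univ, fun r _ s _ b c hb hc' hbc => ?_⟩
  simp only [hFun, proj_nonnegOrthant]
  set r' : Fin N → ℝ := fun n => max 0 (r n)
  set s' : Fin N → ℝ := fun n => max 0 (s n)
  have hr' : 0 ≤ r' := fun n => le_max_left _ _
  have hs' : 0 ≤ s' := fun n => le_max_left _ _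
  -- Shifting by a small `δ` moves boundary points into the open orthant, where `hc` applies, at a
  -- cost of at most `ε`.
  have husc : ∀ q : Fin N → ℝ, 0 ≤ q → ∀ ε : ℝ, 0 < ε → ∀ᶠ δ in 𝓝[>] (0 : ℝ),
      varrho G (vecExp (q + fun _ => δ)) ≤ varrho G (vecExp q) + ε := by
    intro q hq ε hε
    have hcont : Continuous fun δ : ℝ => vecExp (q + fun _ : Fin N => δ) := by
      unfold vecExp
      fun_prop
    have hlim : Tendsto (fun δ : ℝ => vecExp (q + fun _ : Fin N => δ)) (𝓝[>] 0)
        (𝓝 (vecExp q)) := by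
      have := hcont.tendsto 0
      rw [show (q + fun _ => (0 : ℝ)) = q from add_zero q] at this
      exact this.mono_left nhdsWithin_le_nhds
    filter_upwards [hlim.eventually (hG.eventually_varrho_le (vecExp_nonneg hq) hε),
      self_mem_nhdsWithin] with δ hδ (hδ0 : 0 < δ)
    exact hδ (vecExp_nonneg fun n => add_nonneg (hq n) hδ0.le)
  refine le_of_forall_pos_le_add fun ε hε => ?_
  obtain ⟨δ, ⟨hδr, hδs⟩, hδ0⟩ :=
    (((husc r' hr' ε hε).and (husc s' hs' ε hε)).and self_mem_nhdsWithin).exists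
  have hδ0 : 0 < δ := hδ0
  have hconv := hc.2 (x := r' + fun _ => δ) (fun n => add_pos_of_nonneg_of_pos (hr' n) hδ0)
    (y := s' + fun _ => δ) (fun n => add_pos_of_nonneg_of_pos (hs' n) hδ0) hb hc' hbc
  have hle : (fun n => max 0 ((b • r + c • s) n)) ≤
      b • (r' + fun _ => δ) + c • (s' + fun _ => δ) := by
    intro n
    simp only [Pi.add_apply, Pi.smul_apply, smul_eq_mul]
    refine max_le ?_ (add_le_add ?_ ?_)
    · exact add_nonneg (mul_nonneg hb (add_nonneg (hr' n) hδ0.le))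
        (mul_nonneg hc' (add_nonneg (hs' n) hδ0.le))
    · exact mul_le_mul_of_nonneg_left ((le_max_right _ _).trans (le_add_of_nonneg_right hδ0.le)) hb
    · exact mul_le_mul_of_nonneg_left ((le_max_right _ _).trans (le_add_of_nonneg_right hδ0.le)) hc'
  have hmono : varrho G (vecExp fun n => max 0 ((b • r + c • s) n)) ≤ _ :=
    hG.varrho_mono (vecExp_nonneg fun n => le_max_left _ _) (vecExp_mono hle)
  simp only [smul_eq_mul] at hconv ⊢
  have h1 := mul_le_mul_of_nonneg_left hδr hb
  have h2 := mul_le_mul_of_nonneg_left hδs hc'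
  have h3 : b * ε + c * ε = ε := by rw [← add_mul, hbc, one_mul]
  linarith

theorem hFun_of_mem_posOrthant (G : (Fin N → ℝ) → (Fin N → ℝ)) {r : Fin N → ℝ}
    (hr : r ∈ posOrthant N) : hFun G r = varrho G (vecExp r) := by
  rw [hFun, proj_nonnegOrthant, show (fun n => max 0 (r n)) = r from
    funext fun n => max_eq_right (hr n).le]

theorem vecExp_proj_nonneg (r : Fin N → ℝ) : 0 ≤ vecExp (proj (nonnegOrthant N) r) := by
  rw [proj_nonnegOrthant]
  exact vecExp_nonneg fun n => le_max_left _ _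

end Convexity

/-! ### The subgradient for a single matrix. -/

/-- The Perron vectors of `diag(𝔈(r)) B` give a subgradient of `ϱ_B ∘ 𝔈 ∘ P` at `r`. -/
theorem perron_mem_subdifferential [NeZero N] {B : Matrix (Fin N) (Fin N) ℝ}
    (hB : ∀ i j, 0 < B i j)
    (hc : ConvexOn ℝ (posOrthant N) fun r => varrhoMat B (vecExp r))
    {r : Fin N → ℝ} (hr : r ∈ posOrthant N) {ξ η : Fin N → ℝ}
    (hξ : IsRightPerron (Matrix.diagonal (vecExp r) * B) ξ)
    (hη : IsLeftPerron (Matrix.diagonal (vecExp r) * B) η) :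
    (η ⬝ᵥ ξ)⁻¹ • (Matrix.diagonal (fun n => Real.exp (r n)) * Matrix.diagonal η * B).mulVec ξ
      ∈ subdifferential (hFun fun q => B.mulVec q) r := by
  intro y
  have hG := isStronglyMonotone_mulVec hB
  have hconv := hG.convexOn_hFun hc
  set E := vecExp r
  have hE0 : ∀ i, 0 < E i := vecExp_pos hr
  set A := Matrix.diagonal E * B with hA
  have hA0 : ∀ i j, 0 < A i j := fun i j => by
    rw [hA, Matrix.diagonal_mul]
    exact mul_pos (hE0 i) (hB i j)
  have hρ := rhoMat_pos hA0
  have hhr : hFun (fun q => B.mulVec q) r = rhoMat A := by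
    rw [hFun_of_mem_posOrthant _ hr]
    exact varrhoMat_eq_rhoMat B _
  set W := η ⬝ᵥ ξ
  have hW0 : 0 < W := Finset.sum_pos (fun i _ => mul_pos (hη.1 i) (hξ.1 i)) Finset.univ_nonempty
  -- Along the segment `diag(𝔈(r + t(y - r))) B = diag(D t) A`, so `ψ` is the Friedland–Karlin lower
  -- bound for its spectral radius.
  set D : ℝ → Fin N → ℝ := fun t i => (Real.exp (r i + t * (y i - r i)) - 1) / E i with hD
  have hD0 : ∀ i, D 0 i = 1 := fun i => by
    simp only [hD, zero_mul, add_zero]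
    exact div_self (hE0 i).ne'
  set ψ : ℝ → ℝ := fun t => rhoMat A * Real.exp ((∑ i, η i * ξ i * Real.log (D t i)) / W) with hψ
  have hψ0 : ψ 0 = rhoMat A := by simp [hψ, hD0]
  have hderiv : HasDerivAt ψ
      (rhoMat A * ((∑ i, η i * ξ i * (Real.exp (r i) * (y i - r i) / E i)) / W)) 0 := by
    have hlog : ∀ i, HasDerivAt (fun t => Real.log (D t i))
        (Real.exp (r i) * (y i - r i) / E i) 0 := by
      intro i
      have h1 : HasDerivAt (fun t : ℝ => r i + t * (y i - r i)) (y i - r i) 0 := by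
        simpa using ((hasDerivAt_id (0 : ℝ)).mul_const (y i - r i)).const_add (r i)
      have h2 := ((h1.exp.sub_const 1).div_const (E i)).log (by
        have := hD0 i
        simp only [hD] at this
        rw [this]
        exact one_ne_zero)
      have h3 := hD0 i
      simp only [hD] at h3 ⊢
      rw [h3] at h2
      simpa using h2
    have hsum := HasDerivAt.fun_sum (u := Finset.univ) fun i _ =>
      (hlog i).const_mul (η i * ξ i)
    have := ((hsum.div_const W).exp).const_mul (rhoMat A)
    simpa [hD0] using this
  -- Only small `t` are used, since `y` may lie outside the orthant; there `ψ` lies below `h`, and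
  -- `h` below its chord.
  have hlower : ∀ᶠ t in 𝓝[>] (0 : ℝ),
      t⁻¹ • (ψ (0 + t) - ψ 0) ≤ hFun (fun q => B.mulVec q) y - rhoMat A := by
    have hpos : ∀ᶠ t in 𝓝[>] (0 : ℝ), r + t • (y - r) ∈ posOrthant N := by
      have : ∀ᶠ t in 𝓝[>] (0 : ℝ), ∀ i, 0 < r i + t * (y i - r i) := by
        rw [eventually_all]
        intro i
        have hcont : Continuous fun t : ℝ => r i + t * (y i - r i) := by fun_prop
        exact nhdsWithin_le_nhds ((hcont.tendsto 0).eventually_const_lt (by simpa using hr i))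
      exact this
    filter_upwards [hpos, Ioo_mem_nhdsGT (zero_lt_one' ℝ)] with t ht ht01
    have hupper := hconv.2 (Set.mem_univ r) (Set.mem_univ y) (sub_nonneg.mpr ht01.2.le) ht01.1.le
      (sub_add_cancel 1 t)
    rw [show (1 - t) • r + t • y = r + t • (y - r) by module, hhr] at hupper
    have hψle : ψ t ≤ hFun (fun q => B.mulVec q) (r + t • (y - r)) := by
      rw [hFun_of_mem_posOrthant _ ht]
      obtain ⟨hμ, ζ, hζ, hζe⟩ := hG.varrho_spec_pos (vecExp_pos ht)
      set μ := varrho (fun q => B.mulVec q) (vecExp (r + t • (y - r)))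
      have hDt : ∀ i, D t i = vecExp (r + t • (y - r)) i / E i := fun i => rfl
      have hFK := log_rhoMat_add_sum_log_le hA0 hρ hξ hη (D := D t)
        (fun i => div_pos (vecExp_pos ht i) (hE0 i)) hμ hζ fun i => by
          rw [← hζe i, hDt, hA, ← Matrix.mulVec_mulVec, Matrix.mulVec_diagonal]
          have := (hE0 i).ne'
          field_simp
      rw [← Real.log_le_log_iff (mul_pos hρ (Real.exp_pos _)) hμ,
        Real.log_mul hρ.ne' (Real.exp_pos _).ne', Real.log_exp, ← mul_le_mul_iff_right₀ hW0,
        mul_add, mul_div_cancel₀ _ hW0.ne']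
      exact hFK
    rw [zero_add, hψ0, smul_eq_mul, inv_mul_le_iff₀ ht01.1]
    simp only [smul_eq_mul] at hupper
    linarith
  have hle := le_of_tendsto hderiv.tendsto_slope_zero_right hlower
  rw [hhr]
  -- The eigenvector equation `E i (B ξ) i = ρ(A) ξ i` turns the slope of `ψ` into the stated
  -- pairing.
  have hval : (y - r) ⬝ᵥ (W⁻¹ • (Matrix.diagonal (fun n => Real.exp (r n)) * Matrix.diagonal η *
      B).mulVec ξ) =
      rhoMat A * ((∑ i, η i * ξ i * (Real.exp (r i) * (y i - r i) / E i)) / W) := by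
    rw [dotProduct_smul, smul_eq_mul, mul_div_assoc', Finset.mul_sum, div_eq_inv_mul]
    congr 1
    refine Finset.sum_congr rfl fun i _ => ?_
    have hi : E i * B.mulVec ξ i = rhoMat A * ξ i := by
      have := congrFun hξ.2 i
      rwa [hA, ← Matrix.mulVec_mulVec, Matrix.mulVec_diagonal] at this
    rw [← Matrix.mulVec_mulVec, ← Matrix.mulVec_mulVec, Matrix.mulVec_diagonal,
      Matrix.mulVec_diagonal]
    have hEi := (hE0 i).ne'
    have hB' : B.mulVec ξ i = rhoMat A * ξ i / E i := by
      rw [eq_div_iff hEi, mul_comm, hi]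
    rw [hB', Pi.sub_apply]
    ring
  rw [hval]
  linarith

end RateRegion

/-! ### From the matrices `M_l` to `G`. -/

open RateRegion in
theorem proposition2 {N L : ℕ} (M : Matrix (Fin N) (Fin N) ℝ) (hM : ∀ i j, 0 < M i j)
    (u : Fin N → ℝ) (hu : ∀ i, 0 < u i)
    (p : Seminorm ℝ (Fin N → ℝ)) (a : Fin L → Fin N → ℝ) (hp : IsPolyhedralNorm p a)
    (hconv : ∀ l, ConvexOn ℝ (posOrthant N) (fun r => varrhoMat (matMl M u a l) (vecExp r)))
    (r : Fin N → ℝ) (hr : r ∈ posOrthant N)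
    (lstar : Fin L)
    (hl : ∀ l, varrhoMat (matMl M u a l) (vecExp r) ≤ varrhoMat (matMl M u a lstar) (vecExp r)) :
    (∀ l, varrhoMat (matMl M u a l) (vecExp r) = rhoMat (matA M u a r l) ∧
      spectralRadius ℂ ((matA M u a r l).map (fun t : ℝ => (t : ℂ))) =
        ENNReal.ofReal (rhoMat (matA M u a r l))) ∧
    ConvexOn ℝ Set.univ (hFun (mapG M u p)) ∧
    0 < rhoMat (matA M u a r lstar) ∧
    (∃ ξ, IsRightPerron (matA M u a r lstar) ξ) ∧
    (∃ η, IsLeftPerron (matA M u a r lstar) η) ∧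
    ∀ ξ η : Fin N → ℝ,
      IsRightPerron (matA M u a r lstar) ξ → IsLeftPerron (matA M u a r lstar) η →
      (η ⬝ᵥ ξ)⁻¹ • (Matrix.diagonal (fun n => Real.exp (r n)) * Matrix.diagonal η *
          matMl M u a lstar).mulVec ξ
        ∈ subdifferential (hFun (mapG M u p)) r := by
  obtain ⟨n, -⟩ := Function.ne_iff.mp (hp.ne_zero lstar)
  have : NeZero N := ⟨by rintro rfl; exact n.elim0⟩
  have hMl := matMl_pos hM hu hp.nonneg
  have hA : ∀ l i j, 0 < matA M u a r l i j := fun l i j => by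
    rw [matA, Matrix.diagonal_mul]
    exact mul_pos (vecExp_pos hr i) (hMl l i j)
  have hle : ∀ l y, hFun (fun q => (matMl M u a l).mulVec q) y ≤ hFun (mapG M u p) y :=
    fun l y => hp.varrhoMat_le_varrho_mapG hM hu (vecExp_proj_nonneg y) l
  have heq : ∀ y, ∃ l, hFun (mapG M u p) y = hFun (fun q => (matMl M u a l).mulVec q) y :=
    fun y => hp.exists_varrho_mapG_eq hM hu (vecExp_proj_nonneg y)
  refine ⟨fun l => ⟨varrhoMat_eq_rhoMat _ _, spectralRadius_map_ofReal (hA l)⟩,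
    ⟨convex_univ, fun y _ z _ b c hb hc hbc => ?_⟩, rhoMat_pos (hA lstar),
    exists_isRightPerron (hA lstar), exists_isLeftPerron (hA lstar), fun ξ η hξ hη y => ?_⟩
  -- The index is chosen at the convex combination; at `y` and `z` domination by `G` is enough.
  · obtain ⟨l, hl'⟩ := heq (b • y + c • z)
    rw [hl']
    refine (((isStronglyMonotone_mulVec (hMl l)).convexOn_hFun (hconv l)).2 (Set.mem_univ y)
      (Set.mem_univ z) hb hc hbc).trans (add_le_add ?_ ?_)
    · exact mul_le_mul_of_nonneg_left (hle l y) hb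
    · exact mul_le_mul_of_nonneg_left (hle l z) hc
  -- By the choice of `lstar` the minorant for `M_{l⋆}` touches `h_G` at `r`, so its subgradient
  -- there serves `h_G` as well.
  · have hr_le : hFun (mapG M u p) r ≤ hFun (fun q => (matMl M u a lstar).mulVec q) r := by
      obtain ⟨l, hl'⟩ := heq r
      rw [hl', hFun_of_mem_posOrthant _ hr, hFun_of_mem_posOrthant _ hr]
      exact hl l
    exact (add_le_add_right hr_le _).trans
      ((perron_mem_subdifferential (hMl lstar) (hconv lstar) hr hξ hη y).trans (hle lstar y))
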